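/- Let $m\in\tfrac12\mathbb Z_{\ge 0}$ and let $\phi:\mathbb H\times\mathbb C\to\mathbb C$ be a weak Jacobi form of weight $-2m$ and index $m$ which is not identically zero. That is, $\phi$ is holomorphic, satisfies $$\phi(\tau,\alpha+\lambda\tau+\mu)=(-1)^{2m(\lambda+\mu)}e^{-2\pi i m(\lambda^2\tau+2\lambda\alpha)}\phi(\tau,\alpha),\qquad \lambda,\mu\in\mathbb Z,$$ $$\phi\Bigl(\tfrac{a\tau+b}{c\tau+d},\tfrac{\alpha}{c\tau+d}\Bigr)=(c\tau+d)^{-2m}e^{2\pi i m\frac{c\alpha^2}{c\tau+d}}\phi(\tau,\alpha),\qquad \begin{pmatrix}a&b\\c&d\end{pmatrix}\in SL(2,\mathbb Z),$$ and has an absolutely convergent expansion $\phi=\sum_{n\ge0,\;r\in m+\mathbb Z}c(n,r)\,q^n y^r$ with $q=e^{2\pi i\tau}$, $y=e^{2\pi i\alpha}$ (for integral $m$ the sign is trivial and the powers of $y$ are integral). Write $\phi^{(2m)}(\tau,0)$ for the $2m$-th derivative of $\phi$ in its second variable at $0$. Then $\phi^{(2m)}(\tau,0)\neq0$ for all $\tau\in\mathbb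 H$, $\phi(\tau,\alpha)\ne0$ for $\alpha\notin\mathbb Z\tau+\mathbb Z$, and for all $\tau\in\mathbb H$, $\alpha\notin\mathbb Z\tau+\mathbb Z$ there is a convergent expansion near $t=0$, $t\neq 0$, $$\frac{\phi(\tau,t+\alpha)}{\phi(\tau,t)}=\frac{(2m)!\,\phi(\tau,\alpha)}{\phi^{(2m)}(\tau,0)}\,\frac1{t^{2m}}\Bigl(1+\sum_{i\ge1}F_i(\tau,\alpha)\,t^i\Bigr),$$ and every coefficient $F_i$, $i\geq 1$, is a quasi-Jacobi form. Here a quasi-Jacobi form is the constant term $c_{0,0}$ of an almost meromorphic Jacobi form of index zero, i.e. of a function $G=\sum_{j\le s,\,l\le u}c_{j,l}(\tau,\alpha)\,\lambda^j\mu^l$, where now $\lambda=\frac{\alpha-\bar\alpha}{\tau-\bar\tau}$ and $\mu=\frac1{\tau-\bar\tau}$, such that: the $c_{j,l}$ are meromorphic on $\mathbb H\times\mathbb C$ with poles at most along $\alpha\in\mathbb Z\tau+\mathbb Z$ and near $q=0$, $\alpha=0$ lie in $\mathbb C\{q,\alpha\}[\alpha^{-1}]$; $G$ is invariant under $\alpha\mapsto\alpha+a\tau+b$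 for $a,b\in\mathbb Z$; and for some integer weight $k$, $G\bigl(\tfrac{a\tau+b}{c\tau+d},\tfrac{\alpha}{c\tau+d}\bigr)=(c\tau+d)^kG(\tau,\alpha)$ for all $\begin{pmatrix}a&b\\c&d\end{pmatrix}\in SL(2,\mathbb Z)$. -/

import Mathlib

open UpperHalfPlane hiding I
open Complex Filter Topology
open scoped MatrixGroups

noncomputable section

namespace JacobiForms

/-- The automorphy factor `c τ + d` of `γ = (a b; c d)`. -/
def factor (γ : SL(2, ℤ)) (τ : ℍ) : ℂ := ((γ 1 0 : ℤ) : ℂ) * (τ : ℂ) + ((γ 1 1 : ℤ) : ℂ)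

/-- The lattice `ℤ τ + ℤ`. -/
def lattice (τ : ℍ) : Set ℂ := {z | ∃ m n : ℤ, z = (m : ℂ) * (τ : ℂ) + (n : ℂ)}

/-- `φ` is a weak Jacobi form of weight `k` and index `N / 2`.
The sign `(-1) ^ (N * (m + n))` is trivial if the index is an integer; for half-integral index it is
the standard character of `ℤ²`, the one of `θ(τ, α) / θ'(τ, 0)`.  In the Fourier expansion `q` occurs
with exponents `n ≥ 0` and `y` with exponents in `N / 2 + ℤ`. -/
structure IsWeakJacobiForm (k : ℤ) (N : ℕ) (φ : ℍ → ℂ → ℂ) : Prop where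
  holomorphic :
    DifferentiableOn ℂ (fun p : ℂ × ℂ => φ (ofComplex p.1) p.2) {p | 0 < p.1.im}
  translate : ∀ (τ : ℍ) (α : ℂ) (m n : ℤ),
    φ τ (α + m * τ + n) =
      (-1 : ℂ) ^ ((N : ℤ) * (m + n)) *
        cexp (-(2 * Real.pi * I * ((N : ℂ) / 2) * ((m : ℂ) ^ 2 * τ + 2 * m * α))) * φ τ α
  modular : ∀ (γ : SL(2, ℤ)) (τ : ℍ) (α : ℂ),
    φ (γ • τ) (α / factor γ τ) =
      factor γ τ ^ k *
        cexp (2 * Real.pi * I * ((N : ℂ) / 2) * (((γ 1 0 : ℤ) : ℂ) * α ^ 2 / factor γ τ)) * φ τ α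
  fourier : ∃ c : ℕ → ℤ → ℂ, ∀ (τ : ℍ) (α : ℂ),
    HasSum (fun p : ℕ × ℤ =>
      c p.1 p.2 * cexp (2 * Real.pi * I * τ) ^ p.1 *
        cexp (2 * Real.pi * I * α * ((p.2 : ℂ) + (N : ℂ) / 2))) (φ τ α)

/-- The real analytic function `λ(τ, α) = (α - ᾱ) / (τ - τ̄)`. -/
def lam (τ : ℍ) (α : ℂ) : ℂ :=
  (α - starRingEnd ℂ α) / ((τ : ℂ) - starRingEnd ℂ (τ : ℂ))

/-- The real analytic function `μ(τ) = 1 / (τ - τ̄)`. -/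
def mu (τ : ℍ) : ℂ := 1 / ((τ : ℂ) - starRingEnd ℂ (τ : ℂ))

/-- The coefficient functions of almost meromorphic Jacobi forms: meromorphic functions on `ℍ × ℂ`
with poles at most along `α ∈ ℤ τ + ℤ` (only values off the lattice matter), which near
`(q, α) = (0, 0)` are given by an element of `ℂ{q, α}[α⁻¹]`. -/
structure IsCoefficient (c : ℍ → ℂ → ℂ) : Prop where
  holomorphic : DifferentiableOn ℂ (fun p : ℂ × ℂ => c (ofComplex p.1) p.2)
    {p | 0 < p.1.im ∧ p.2 ∉ lattice (ofComplex p.1)}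
  meromorphic : ∀ (τ₀ : ℍ) (m n : ℤ), ∃ (k : ℕ) (g : ℂ × ℂ → ℂ),
    AnalyticAt ℂ g ((τ₀ : ℂ), (m : ℂ) * τ₀ + n) ∧
    ∀ᶠ p : ℂ × ℂ in 𝓝 ((τ₀ : ℂ), (m : ℂ) * τ₀ + n), p.2 ∉ lattice (ofComplex p.1) →
      (p.2 - (m * p.1 + n)) ^ k * c (ofComplex p.1) p.2 = g p
  cusp : ∃ (k : ℕ) (g : ℂ × ℂ → ℂ) (ε : ℝ), 0 < ε ∧ AnalyticAt ℂ g (0, 0) ∧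
    ∀ (τ : ℍ) (α : ℂ), ‖cexp (2 * Real.pi * I * τ)‖ < ε → ‖α‖ < ε → α ∉ lattice τ →
      α ^ k * c τ α = g (cexp (2 * Real.pi * I * τ), α)

/-- The function `∑ c_{jl} λ^j μ^l` (sum over `j ≤ s`, `l ≤ t`). -/
def polyLamMu (s t : ℕ) (c : ℕ → ℕ → ℍ → ℂ → ℂ) (τ : ℍ) (α : ℂ) : ℂ :=
  ∑ j ∈ Finset.range (s + 1), ∑ l ∈ Finset.range (t + 1), c j l τ α * lam τ α ^ j * mu τ ^ l

/-- The polynomial in `λ`, `μ` with coefficients `c j l` (for `j ≤ s`, `l ≤ t`) is an almost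
meromorphic Jacobi form of weight `k`, index zero and depth `(s, t)`. -/
structure IsAlmostMeromorphicJacobiForm (k : ℤ) (s t : ℕ) (c : ℕ → ℕ → ℍ → ℂ → ℂ) : Prop where
  coefficient : ∀ j ≤ s, ∀ l ≤ t, IsCoefficient (c j l)
  translate : ∀ (τ : ℍ) (α : ℂ) (m n : ℤ), α ∉ lattice τ →
    polyLamMu s t c τ (α + m * τ + n) = polyLamMu s t c τ α
  modular : ∀ (γ : SL(2, ℤ)) (τ : ℍ) (α : ℂ), α ∉ lattice τ →
    polyLamMu s t c (γ • τ) (α / factor γ τ) = factor γ τ ^ k * polyLamMu s t c τ α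

/-- A quasi-Jacobi form: the constant term, as a polynomial in `λ` and `μ`, of an almost meromorphic
Jacobi form of index zero (of some weight and depth).  It is a function of `τ` and of
`α ∉ ℤ τ + ℤ`. -/
def IsQuasiJacobiForm (f : ℍ → ℂ → ℂ) : Prop :=
  ∃ (k : ℤ) (s t : ℕ) (c : ℕ → ℕ → ℍ → ℂ → ℂ), IsAlmostMeromorphicJacobiForm k s t c ∧
    ∀ (τ : ℍ) (α : ℂ), α ∉ lattice τ → f τ α = c 0 0 τ α

end JacobiForms

end

/-! Write `N = 2m` and let `theta` be the Jacobi theta function scaled to have derivative one at the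
origin. The key fact is rigidity: `φ` is a nonzero constant times `theta ^ N`
(`IsWeakJacobiForm.eq_const_mul`). By induction, the Taylor coefficients of `φ` in `α` of order `n <
N` are level-one modular forms of negative weight `n - N`, hence zero, and the coefficient of order
`N` then has weight zero, hence is constant. For fixed `τ`, the function `φ / theta ^ N` is
therefore entire and doubly periodic, so a constant by Liouville; the constant order-`N` coefficient
makes it independent of `τ`. The product formula locates the zeros of `theta` exactly on the
lattice, which gives the two nonvanishing claims.

Consequently `c t^N φ(t + α) / (φ(t) φ(α))` extends holomorphically to `t = 0` with value 1, and the
`F_i` are its Taylor coefficients (`taylorCoeff`). A translation of `α` by `mτ + n` multiplies it by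
`exp(-2πi N m t)`, and a modular transformation introduces the cross term `exp(2πi N c α t)` of the
quadratic exponent, where `c` is now the lower left entry of the matrix. The factor `exp(2πi N λ t)`
cancels both, because `λ` becomes `λ + m` and `(cτ + d) λ - c α` respectively. The `t^i` coefficient
of the completed function thus has weight `i` and is a polynomial in `λ` alone, with constant term
`F_i`.

The coefficients are admissible because `t`-derivatives of `theta(t + α)^N` over a nonvanishing
factor are analytic for `|q| < 1`, including `q = 0`, and are divided only by `theta(α)^N`. The
modular law of theta is never proved separately: it is inherited from `φ`. -/

namespace JacobiForms

open MeasureTheory BoundedContinuousFunction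

/-! ### Analyticity in two complex variables -/

/-- The inverse of `a - z` in the algebra of bounded continuous functions is analytic in `z`. -/
lemma analyticAt_inverse_sub {X : Type*} [TopologicalSpace X] (a : X →ᵇ ℂ) (z₀ : ℂ)
    (h : IsUnit (a - algebraMap ℂ (X →ᵇ ℂ) z₀)) :
    AnalyticAt ℂ (fun z : ℂ => Ring.inverse (a - algebraMap ℂ (X →ᵇ ℂ) z)) z₀ := by
  obtain ⟨u, hu⟩ := h
  have h1 : AnalyticAt ℂ (fun z : ℂ => a - algebraMap ℂ (X →ᵇ ℂ) z) z₀ :=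
    analyticAt_const.sub ((algebraMapCLM ℂ (X →ᵇ ℂ)).analyticAt z₀)
  have h2 : AnalyticAt ℂ Ring.inverse (a - algebraMap ℂ (X →ᵇ ℂ) z₀) := by
    rw [← hu]; exact analyticAt_inverse u
  exact h2.comp (f := fun z : ℂ => a - algebraMap ℂ (X →ᵇ ℂ) z) h1

lemma eventually_inverse_sub_apply {X : Type*} [TopologicalSpace X] (a : X →ᵇ ℂ) (z₀ : ℂ)
    (h : IsUnit (a - algebraMap ℂ (X →ᵇ ℂ) z₀)) :
    ∀ᶠ z in 𝓝 z₀, ∀ x, Ring.inverse (a - algebraMap ℂ (X →ᵇ ℂ) z) x = (a x - z)⁻¹ := by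
  have hc : Continuous (fun z : ℂ => a - algebraMap ℂ (X →ᵇ ℂ) z) := by
    simp only [Algebra.algebraMap_eq_smul_one]; fun_prop
  filter_upwards [hc.continuousAt.preimage_mem_nhds (Units.isOpen.mem_nhds h)] with z hz x
  have := congrArg (fun b : X →ᵇ ℂ => b x) (Ring.inverse_mul_cancel _ hz)
  simp only [BoundedContinuousFunction.coe_mul, Pi.mul_apply, BoundedContinuousFunction.coe_sub,
    Pi.sub_apply, BoundedContinuousFunction.coe_one, Pi.one_apply,
    BoundedContinuousFunction.algebraMap_apply, smul_eq_mul, mul_one] at this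
  exact eq_inv_of_mul_eq_one_left this

/-- Integration against a finite measure, as a functional on bounded continuous functions. -/
noncomputable def integralFunctional {X : Type*} [TopologicalSpace X] [MeasurableSpace X]
    [OpensMeasurableSpace X] (μ : Measure X) [IsFiniteMeasure μ] : (X →ᵇ ℂ) →L[ℂ] ℂ :=
  LinearMap.mkContinuous
    { toFun := fun g => ∫ x, g x ∂μ
      map_add' := fun f g => integral_add (f.integrable μ) (g.integrable μ)
      map_smul' := fun c f => integral_const_mul c _ }
    (μ.real Set.univ) (fun g => by
      simpa using norm_integral_le_of_norm_le_const (μ := μ)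
        (.of_forall fun x => g.norm_coe_le_norm x) |>.trans_eq (mul_comm _ _))

/-- Osgood's lemma in two variables. -/
theorem analyticOnNhd_of_separately {f : ℂ × ℂ → ℂ} {U : Set (ℂ × ℂ)} (hU : IsOpen U)
    (hc : ContinuousOn f U)
    (h1 : ∀ p ∈ U, DifferentiableAt ℂ (fun z => f (z, p.2)) p.1)
    (h2 : ∀ p ∈ U, DifferentiableAt ℂ (fun w => f (p.1, w)) p.2) : AnalyticOnNhd ℂ f U := by
  rintro ⟨z₀, w₀⟩ hp
  obtain ⟨r, hr, hrU⟩ := Metric.nhds_basis_closedBall.mem_iff.1 (hU.mem_nhds hp)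
  rw [← closedBall_prod_same] at hrU
  have hcirc : ∀ (c : ℂ) (θ : ℝ), circleMap c r θ ∈ Metric.closedBall c r :=
    fun c θ => circleMap_mem_closedBall c hr.le θ
  let a (c : ℂ) (i : ℝ × ℝ → ℝ) (hi : Continuous i) : ℝ × ℝ →ᵇ ℂ :=
    .ofNormedAddCommGroup (fun x => circleMap c r (i x)) (by fun_prop) (‖c‖ + r) (fun x => by
      refine (norm_add_le _ _).trans ?_
      simp [abs_of_pos hr])
  -- On the circle, `ζ - c = r e^{iθ}` has an inverse bounded by `1 / r`, so it is a unit of the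
  -- Banach algebra.
  have ha (c : ℂ) (i hi) : IsUnit (a c i hi - algebraMap ℂ _ c) := by
    refine IsUnit.of_mul_eq_one (.ofNormedAddCommGroup
      (fun x => ((r : ℂ) * cexp (i x * I))⁻¹) (by
        refine Continuous.inv₀ (by fun_prop) (fun x => by simp [hr.ne'])) (r⁻¹) (fun x => by
          simp [Complex.norm_exp, abs_of_pos hr])) ?_
    ext x
    have : (r : ℂ) ≠ 0 := by exact_mod_cast hr.ne'
    simp [a, circleMap]
    field_simp
  have hcf : Continuous (fun x : ℝ × ℝ => f (circleMap z₀ r x.1, circleMap w₀ r x.2)) :=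
    hc.comp_continuous (by fun_prop) (fun x => hrU ⟨hcirc _ _, hcirc _ _⟩)
  obtain ⟨M, hM⟩ : ∃ M, ∀ p ∈ Metric.closedBall z₀ r ×ˢ Metric.closedBall w₀ r, ‖f p‖ ≤ M :=
    ((isCompact_closedBall z₀ r).prod (isCompact_closedBall w₀ r)).exists_bound_of_continuousOn
      (hc.mono hrU)
  let g : ℝ × ℝ →ᵇ ℂ := .ofNormedAddCommGroup
    (fun x => (r * cexp (x.1 * I) * I) * (r * cexp (x.2 * I) * I) *
      f (circleMap z₀ r x.1, circleMap w₀ r x.2))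
    (Continuous.mul (by fun_prop) hcf) (r * r * M)
    (fun x => by
      simp only [norm_mul, Complex.norm_real, Complex.norm_exp_ofReal_mul_I, Complex.norm_I,
        mul_one,
        Real.norm_eq_abs, abs_of_pos hr]
      gcongr
      exact hM _ ⟨hcirc _ _, hcirc _ _⟩)
  let μ : Measure (ℝ × ℝ) := (volume.restrict (Set.Ioc 0 (2 * Real.pi))).prod
    (volume.restrict (Set.Ioc 0 (2 * Real.pi)))
  -- The Cauchy kernel is analytic as a map into bounded continuous functions, and integration is a
  -- continuous functional; hence the iterated Cauchy integral is analytic in `p` with no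
  -- differentiation under the integral.
  have han : AnalyticAt ℂ (fun p : ℂ × ℂ => (2 * Real.pi * I)⁻¹ * (2 * Real.pi * I)⁻¹ *
      integralFunctional μ (Ring.inverse (a z₀ Prod.fst continuous_fst - algebraMap ℂ _ p.1) *
      Ring.inverse (a w₀ Prod.snd continuous_snd - algebraMap ℂ _ p.2) * g)) (z₀, w₀) := by
    refine analyticAt_const.mul (((integralFunctional μ).analyticAt _).comp ?_)
    refine (AnalyticAt.mul ?_ ?_).mul analyticAt_const
    · exact (analyticAt_inverse_sub _ _ (ha z₀ _ continuous_fst)).comp (x := (z₀, w₀))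
        (g := fun z => Ring.inverse (a z₀ Prod.fst continuous_fst - algebraMap ℂ _ z))
        analyticAt_fst
    · exact (analyticAt_inverse_sub _ _ (ha w₀ _ continuous_snd)).comp (x := (z₀, w₀))
        (g := fun z => Ring.inverse (a w₀ Prod.snd continuous_snd - algebraMap ℂ _ z))
        analyticAt_snd
  refine han.congr ?_
  have e1 := (continuousAt_fst (p := (z₀, w₀))).eventually
    (eventually_inverse_sub_apply (a z₀ Prod.fst continuous_fst) z₀
      (ha z₀ Prod.fst continuous_fst))
  have e2 := (continuousAt_snd (p := (z₀, w₀))).eventually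
    (eventually_inverse_sub_apply (a w₀ Prod.snd continuous_snd) w₀
      (ha w₀ Prod.snd continuous_snd))
  have e3 : ∀ᶠ p : ℂ × ℂ in 𝓝 (z₀, w₀), p.1 ∈ Metric.ball z₀ r :=
    (continuousAt_fst (p := (z₀, w₀))).eventually (Metric.ball_mem_nhds _ hr)
  have e4 : ∀ᶠ p : ℂ × ℂ in 𝓝 (z₀, w₀), p.2 ∈ Metric.ball w₀ r :=
    (continuousAt_snd (p := (z₀, w₀))).eventually (Metric.ball_mem_nhds _ hr)
  filter_upwards [e1, e2, e3, e4] with p h1p h2p h3p h4p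
  have hpi : (2 * Real.pi * I : ℂ) ≠ 0 := Complex.two_pi_I_ne_zero
  set B : ℝ × ℝ →ᵇ ℂ := Ring.inverse (a z₀ Prod.fst continuous_fst - algebraMap ℂ _ p.1) *
      Ring.inverse (a w₀ Prod.snd continuous_snd - algebraMap ℂ _ p.2) * g with hB
  have hval : integralFunctional μ B = ∮ ζ in C(z₀, r), (ζ - p.1)⁻¹ •
      ∮ ξ in C(w₀, r), (ξ - p.2)⁻¹ • f (ζ, ξ) := by
    change ∫ x, B x ∂μ = _
    rw [integral_prod _ (B.integrable μ)]
    simp only [circleIntegral, intervalIntegral.integral_of_le Real.two_pi_pos.le]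
    refine integral_congr_ae (.of_forall fun θ => ?_)
    simp only [smul_eq_mul]
    rw [← mul_assoc, ← integral_const_mul]
    refine integral_congr_ae (.of_forall fun θ' => ?_)
    simp only [hB, BoundedContinuousFunction.coe_mul, Pi.mul_apply, h1p, h2p]
    simp only [a, g, BoundedContinuousFunction.coe_ofNormedAddCommGroup, deriv_circleMap, circleMap]
    ring
  have hin : ∀ ζ ∈ Metric.closedBall z₀ r, (∮ ξ in C(w₀, r), (ξ - p.2)⁻¹ • f (ζ, ξ)) =
      (2 * Real.pi * I : ℂ) • f (ζ, p.2) := fun ζ hζ =>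
    DifferentiableOn.circleIntegral_sub_inv_smul (f := fun ξ => f (ζ, ξ))
      (fun ξ hξ => (h2 (ζ, ξ) (hrU ⟨hζ, hξ⟩)).differentiableWithinAt) h4p
  have hout : (∮ ζ in C(z₀, r), (ζ - p.1)⁻¹ • f (ζ, p.2)) = (2 * Real.pi * I : ℂ) • f (p.1, p.2) :=
    DifferentiableOn.circleIntegral_sub_inv_smul (f := fun ζ => f (ζ, p.2))
      (fun ζ hζ => (h1 (ζ, p.2) (hrU ⟨hζ,
        Metric.ball_subset_closedBall h4p⟩)).differentiableWithinAt) h3p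
  have : (∮ ζ in C(z₀, r), (ζ - p.1)⁻¹ • ∮ ξ in C(w₀, r), (ξ - p.2)⁻¹ • f (ζ, ξ)) =
      (2 * Real.pi * I : ℂ) • ((2 * Real.pi * I : ℂ) • f (p.1, p.2)) := by
    rw [← hout, ← circleIntegral.integral_smul]
    refine circleIntegral.integral_congr hr.le (fun ζ hζ => ?_)
    rw [hin ζ (Metric.sphere_subset_closedBall hζ), smul_comm]
  rw [hval, this]
  simp only [smul_eq_mul]
  field_simp

/-- A function which is complex differentiable on an open subset of `ℂ × ℂ` is analytic there. -/
theorem analyticOnNhd_of_differentiableOn {f : ℂ × ℂ → ℂ} {U : Set (ℂ × ℂ)} (hU : IsOpen U)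
    (hf : DifferentiableOn ℂ f U) : AnalyticOnNhd ℂ f U := by
  refine analyticOnNhd_of_separately hU hf.continuousOn (fun p hp => ?_) (fun p hp => ?_)
  · exact (hf.differentiableAt (hU.mem_nhds hp)).comp (f := fun z => (z, p.2)) p.1
      (by fun_prop)
  · exact (hf.differentiableAt (hU.mem_nhds hp)).comp (f := fun w => (p.1, w)) p.2
      (by fun_prop)

/-- Locally uniform limits of analytic functions of two variables are analytic. -/
theorem analyticOnNhd_of_tendstoLocallyUniformlyOn {ι : Type*} {l : Filter ι} [l.NeBot]
    {F : ι → ℂ × ℂ → ℂ} {f : ℂ × ℂ → ℂ} {U : Set (ℂ × ℂ)} (hU : IsOpen U)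
    (h : TendstoLocallyUniformlyOn F f l U) (hF : ∀ i, DifferentiableOn ℂ (F i) U) :
    AnalyticOnNhd ℂ f U := by
  refine analyticOnNhd_of_separately hU
    (h.continuousOn (Frequently.of_forall fun i => (hF i).continuousOn))
    (fun p hp => ?_) (fun p hp => ?_)
  · have ho : IsOpen ((fun z : ℂ => (z, p.2)) ⁻¹' U) := hU.preimage (by fun_prop)
    have := (h.comp (fun z : ℂ => (z, p.2)) (fun z hz => hz) (by fun_prop)).differentiableOn
      (.of_forall fun i => (hF i).comp (by fun_prop) (fun z hz => hz)) ho
    exact this.differentiableAt (ho.mem_nhds hp)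
  · have ho : IsOpen ((fun z : ℂ => (p.1, z)) ⁻¹' U) := hU.preimage (by fun_prop)
    have := (h.comp (fun z : ℂ => (p.1, z)) (fun z hz => hz) (by fun_prop)).differentiableOn
      (.of_forall fun i => (hF i).comp (by fun_prop) (fun z hz => hz)) ho
    exact this.differentiableAt (ho.mem_nhds hp)

/-! ### The normalized theta function -/

/-- The infinite product `∏ (1 - q ^ n w)` over `n ≥ 0`. -/
noncomputable def qProd (q w : ℂ) : ℂ := ∏' n : ℕ, (1 + -(q ^ n * w))

lemma summable_norm_qProd {q : ℂ} (hq : ‖q‖ < 1) (w : ℂ) :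
    Summable (fun n : ℕ => ‖-(q ^ n * w)‖) := by
  simpa using (summable_geometric_of_lt_one (norm_nonneg _) hq).mul_right ‖w‖

lemma isOpen_norm_fst_lt_one : IsOpen {p : ℂ × ℂ | ‖p.1‖ < 1} :=
  isOpen_lt (by fun_prop) (by fun_prop)

/-- On a compact set `|q| ≤ ρ < 1` and `|w| ≤ R`, so the Weierstrass test applies with the majorant
`ρ ^ n R`. -/
lemma analyticOnNhd_qProd :
    AnalyticOnNhd ℂ (fun p : ℂ × ℂ => qProd p.1 p.2) {p | ‖p.1‖ < 1} := by
  refine analyticOnNhd_of_tendstoLocallyUniformlyOn isOpen_norm_fst_lt_one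
    (F := fun s p => ∏ i ∈ s, (1 + -(p.1 ^ i * p.2))) (l := atTop)
    (hasProdLocallyUniformlyOn_iff_tendstoLocallyUniformlyOn.1 ?_) 
    (fun s p _ => (Finset.analyticAt_fun_prod s (fun i _ => analyticAt_const.add
      ((analyticAt_fst.pow i).mul analyticAt_snd).neg)).differentiableAt.differentiableWithinAt)
  refine hasProdLocallyUniformlyOn_of_forall_compact isOpen_norm_fst_lt_one (fun K hK hcK => ?_)
  rcases K.eq_empty_or_nonempty with hN | hN
  · simpa [hasProdUniformlyOn_iff_tendstoUniformlyOn, hN] using tendstoUniformlyOn_empty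
  · obtain ⟨p₀, hp₀, h₀⟩ := hcK.exists_isMaxOn hN
      (show ContinuousOn (fun p : ℂ × ℂ => ‖p.1‖) K by fun_prop)
    obtain ⟨R, hR⟩ := hcK.exists_bound_of_continuousOn
      (show ContinuousOn (fun p : ℂ × ℂ => p.2) K by fun_prop)
    refine ((summable_geometric_of_lt_one (norm_nonneg p₀.1) (hK hp₀)).mul_right
      R).hasProdUniformlyOn_nat_one_add hcK (.of_forall fun n x hx => ?_) (fun _ => by fun_prop)
    have h1 : ‖x.1‖ ≤ ‖p₀.1‖ := h₀ hx
    have h2 := hR x hx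
    simp only [norm_neg, norm_mul, norm_pow]
    gcongr

lemma qProd_eq_mul {q : ℂ} (hq : ‖q‖ < 1) (w : ℂ) : qProd q w = (1 - w) * qProd q (q * w) := by
  have h := multipliable_one_add_of_summable (summable_norm_qProd hq (q * w))
  have e : (fun n : ℕ => 1 + -(q ^ n * (q * w))) = fun n => 1 + -(q ^ (n + 1) * w) := by
    ext n; ring
  rw [e] at h
  simp only [qProd]
  rw [tprod_eq_zero_mul' (f := fun n : ℕ => 1 + -(q ^ n * w)) h, ← e]
  simp [sub_eq_add_neg]

lemma qProd_eq_zero_iff {q : ℂ} (hq : ‖q‖ < 1) (w : ℂ) :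
    qProd q w = 0 ↔ ∃ n : ℕ, q ^ n * w = 1 := by
  constructor
  · intro h
    by_contra! hn
    exact tprod_one_add_ne_zero_of_summable (fun n h0 => hn n (by linear_combination -h0))
      (summable_norm_qProd hq w) h
  · rintro ⟨n, hn⟩
    exact tprod_of_exists_eq_zero ⟨n, by simp [hn]⟩

/-- The entire function `sin (π α) / α`. -/
noncomputable def sinQuot (α : ℂ) : ℂ := dslope (fun z => sin (Real.pi * z)) 0 α

lemma mul_sinQuot (α : ℂ) : α * sinQuot α = sin (Real.pi * α) := by
  simpa [sinQuot] using sub_smul_dslope (fun z : ℂ => sin (Real.pi * z)) 0 α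

lemma sinQuot_zero : sinQuot 0 = Real.pi := by
  rw [sinQuot, dslope_same]
  have : HasDerivAt (fun z : ℂ => sin (Real.pi * z)) (cos (Real.pi * 0) * (Real.pi * 1)) 0 :=
    ((hasDerivAt_id' (0 : ℂ)).const_mul _).csin
  rw [this.deriv]; simp

lemma analyticAt_sinQuot (α : ℂ) : AnalyticAt ℂ sinQuot α := by
  have : DifferentiableOn ℂ sinQuot Set.univ :=
    (Complex.differentiableOn_dslope univ_mem).2 (by fun_prop)
  exact (differentiableOn_univ.1 this).analyticAt α

/-- The theta function divided by `α` and by its first derivative at `α = 0`, as a function of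
`q` and `α`. -/
noncomputable def thetaQuot (q α : ℂ) : ℂ :=
  sinQuot α * qProd q (q * cexp (2 * Real.pi * I * α)) * qProd q (q * cexp (-(2 * Real.pi * I * α)))
    / (Real.pi * qProd q q ^ 2)

/-- The theta function, divided by its first derivative at `α = 0`. -/
noncomputable def theta (q α : ℂ) : ℂ := α * thetaQuot q α

lemma qProd_self_ne_zero {q : ℂ} (hq : ‖q‖ < 1) : qProd q q ≠ 0 := by
  rw [Ne, qProd_eq_zero_iff hq]
  rintro ⟨n, hn⟩
  have : ‖q‖ ^ (n + 1) = 1 := by rw [← norm_pow, pow_succ, hn, norm_one]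
  exact (pow_lt_one₀ (norm_nonneg _) hq (Nat.succ_ne_zero n)).ne this

lemma thetaQuot_zero {q : ℂ} (hq : ‖q‖ < 1) : thetaQuot q 0 = 1 := by
  have h1 := qProd_self_ne_zero hq
  have h2 : (Real.pi : ℂ) ≠ 0 := by exact_mod_cast Real.pi_ne_zero
  simp [thetaQuot, sinQuot_zero]
  field_simp

lemma analyticOnNhd_thetaQuot :
    AnalyticOnNhd ℂ (fun p : ℂ × ℂ => thetaQuot p.1 p.2) {p | ‖p.1‖ < 1} := by
  intro p hp
  have h2 : (Real.pi : ℂ) ≠ 0 := by exact_mod_cast Real.pi_ne_zero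
  have hs : AnalyticAt ℂ (fun p : ℂ × ℂ => sinQuot p.2) p :=
    (analyticAt_sinQuot p.2).comp analyticAt_snd
  have key (f : ℂ × ℂ → ℂ) (hf : AnalyticAt ℂ f p) :
      AnalyticAt ℂ (fun p : ℂ × ℂ => qProd p.1 (f p)) p :=
    (analyticOnNhd_qProd (p.1, f p) hp).comp (f := fun p : ℂ × ℂ => (p.1, f p))
      (analyticAt_fst.prod hf)
  have hE (s : ℂ) : AnalyticAt ℂ (fun p : ℂ × ℂ => p.1 * cexp (s * p.2)) p :=
    analyticAt_fst.mul ((analyticAt_const.mul analyticAt_snd).cexp)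
  have h3 := key _ (hE (2 * Real.pi * I))
  have h4 := key _ (hE (-(2 * Real.pi * I)))
  simp only [neg_mul] at h4
  exact ((hs.mul h3).mul h4).div (analyticAt_const.mul ((key _ analyticAt_fst).pow 2))
    (mul_ne_zero h2 (pow_ne_zero _ (qProd_self_ne_zero hp)))

/-- The sine supplies the missing factor `1 - y` of the first product. In this form `α ↦ α + τ`
merely shifts the index in both products. -/
lemma theta_eq {q : ℂ} (hq : ‖q‖ < 1) (α : ℂ) :
    theta q α = cexp (-(Real.pi * I * α)) * qProd q (cexp (2 * Real.pi * I * α)) *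
      qProd q (q * cexp (-(2 * Real.pi * I * α))) / (-2 * I * Real.pi * qProd q q ^ 2) := by
  have h1 := qProd_self_ne_zero hq
  have h2 : (Real.pi : ℂ) ≠ 0 := by exact_mod_cast Real.pi_ne_zero
  have e1 : cexp (2 * Real.pi * I * α) = cexp (Real.pi * α * I) * cexp (Real.pi * α * I) := by
    rw [← Complex.exp_add]; ring_nf
  have e2 : cexp (-(Real.pi * I * α)) = cexp (-(Real.pi * α) * I) := by ring_nf
  have e3 : cexp (-(Real.pi * α) * I) * cexp (Real.pi * α * I) = 1 := by
    rw [← Complex.exp_add]; simp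
  have key : α * sinQuot α * (-2 * I) =
      cexp (-(Real.pi * I * α)) * (1 - cexp (2 * Real.pi * I * α)) := by
    rw [mul_sinQuot, Complex.sin, e1, e2]
    linear_combination (cexp (Real.pi * α * I)) * e3 -
      (cexp (-(Real.pi * α) * I) - cexp (Real.pi * α * I)) * I_sq
  rw [qProd_eq_mul hq (cexp (2 * Real.pi * I * α)), theta, thetaQuot, ← mul_assoc, ← key]
  field_simp

lemma theta_add_one {q : ℂ} (hq : ‖q‖ < 1) (α : ℂ) : theta q (α + 1) = -theta q α := by
  have e1 : cexp (2 * Real.pi * I * (α + 1)) = cexp (2 * Real.pi * I * α) := by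
    rw [mul_add, Complex.exp_add]; simp
  have e2 : cexp (-(Real.pi * I * (α + 1))) = -cexp (-(Real.pi * I * α)) := by
    rw [mul_add, neg_add, Complex.exp_add, Complex.exp_neg (Real.pi * I * 1)]; simp
  have e3 : cexp (-(2 * Real.pi * I * (α + 1))) = cexp (-(2 * Real.pi * I * α)) := by
    rw [Complex.exp_neg, e1, Complex.exp_neg]
  rw [theta_eq hq, theta_eq hq, e1, e2, e3]
  ring

/-- The modular parameter `q = exp (2 π i τ)`. -/
noncomputable def nome (τ : ℂ) : ℂ := cexp (2 * Real.pi * I * τ)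

lemma norm_nome_lt_one {τ : ℂ} (hτ : 0 < τ.im) : ‖nome τ‖ < 1 :=
  norm_exp_two_pi_I_lt_one ⟨τ, hτ⟩

/-- Replacing `y` by `q y` removes `1 - y` from one product and adds `1 - y⁻¹` to the other; their
ratio `-y⁻¹` and the exponential prefactor give the multiplier. -/
lemma theta_add_tau (τ : ℍ) (α : ℂ) :
    theta (nome τ) (α + τ) = -cexp (-(Real.pi * I * (τ + 2 * α))) * theta (nome τ) α := by
  have hq := norm_nome_lt_one τ.2
  set q := nome τ with hqd
  have e1 : cexp (2 * Real.pi * I * (α + τ)) = q * cexp (2 * Real.pi * I * α) := by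
    rw [hqd, nome, ← Complex.exp_add]; ring_nf
  have e3 : q * cexp (-(2 * Real.pi * I * (α + τ))) = cexp (-(2 * Real.pi * I * α)) := by
    rw [hqd, nome, ← Complex.exp_add]; ring_nf
  have e2 : cexp (-(Real.pi * I * (α + τ))) * cexp (2 * Real.pi * I * α) =
      cexp (-(Real.pi * I * α)) * cexp (-(Real.pi * I * (τ + 2 * α))) *
        (cexp (2 * Real.pi * I * α) * cexp (2 * Real.pi * I * α)) := by
    simp only [← Complex.exp_add]; ring_nf
  have e4 : cexp (2 * Real.pi * I * α) * cexp (-(2 * Real.pi * I * α)) = 1 := by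
    rw [← Complex.exp_add]; simp
  rw [theta_eq hq, theta_eq hq, e1, e3, qProd_eq_mul hq (cexp (2 * Real.pi * I * α)),
    qProd_eq_mul hq (cexp (-(2 * Real.pi * I * α)))]
  have e5 : cexp (-(Real.pi * I * (α + τ))) * (1 - cexp (-(2 * Real.pi * I * α))) =
      -(cexp (-(Real.pi * I * α)) * cexp (-(Real.pi * I * (τ + 2 * α)))) *
        (1 - cexp (2 * Real.pi * I * α)) := by
    have hne := Complex.exp_ne_zero (2 * Real.pi * I * α)
    have e2' : cexp (-(Real.pi * I * (α + τ))) = cexp (-(Real.pi * I * α)) *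
      cexp (-(Real.pi * I * (τ + 2 * α))) * cexp (2 * Real.pi * I * α) := by
      simp only [← Complex.exp_add]; ring_nf
    rw [e2']
    linear_combination (-(cexp (-(Real.pi * I * α)) * cexp (-(Real.pi * I * (τ + 2 * α))))) * e4
  linear_combination (qProd q (q * cexp (2 * Real.pi * I * α)) *
    qProd q (q * cexp (-(2 * Real.pi * I * α))) / (-2 * I * Real.pi * qProd q q ^ 2)) * e5

lemma theta_eq_zero_iff (τ : ℍ) (α : ℂ) : theta (nome τ) α = 0 ↔ α ∈ lattice τ := by
  have hq := norm_nome_lt_one τ.2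
  have h1 := qProd_self_ne_zero hq
  have h2 : (Real.pi : ℂ) ≠ 0 := by exact_mod_cast Real.pi_ne_zero
  have h3 : (-2 * I * Real.pi * qProd (nome τ) (nome τ) ^ 2 : ℂ) ≠ 0 := by simp [h1]
  have hpi : (2 * Real.pi * I : ℂ) ≠ 0 := Complex.two_pi_I_ne_zero
  rw [theta_eq hq, div_eq_zero_iff, or_iff_left h3, mul_eq_zero, mul_eq_zero,
    or_iff_right (Complex.exp_ne_zero _), qProd_eq_zero_iff hq, qProd_eq_zero_iff hq]
  have k1 (n : ℕ) : nome τ ^ n * cexp (2 * Real.pi * I * α) = 1 ↔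
      ∃ k : ℤ, (n : ℂ) * (τ : ℂ) + α = k := by
    rw [nome, ← Complex.exp_nat_mul, ← Complex.exp_add, Complex.exp_eq_one_iff]
    refine exists_congr fun k => ?_
    exact ⟨fun h => mul_left_cancel₀ hpi (by linear_combination h),
      fun h => by linear_combination (2 * Real.pi * I) * h⟩
  have k2 (n : ℕ) : nome τ ^ n * (nome τ * cexp (-(2 * Real.pi * I * α))) = 1 ↔
      ∃ k : ℤ, ((n : ℂ) + 1) * (τ : ℂ) - α = k := by
    rw [nome, ← Complex.exp_nat_mul, ← Complex.exp_add, ← Complex.exp_add, Complex.exp_eq_one_iff]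
    refine exists_congr fun k => ?_
    exact ⟨fun h => mul_left_cancel₀ hpi (by linear_combination h),
      fun h => by linear_combination (2 * Real.pi * I) * h⟩
  simp only [k1, k2]
  constructor
  · rintro (⟨n, k, h⟩ | ⟨n, k, h⟩)
    · exact ⟨-n, k, by push_cast; linear_combination h⟩
    · exact ⟨n + 1, -k, by push_cast; linear_combination -h⟩
  · rintro ⟨m, n, h⟩
    -- Zeros `m τ + n` with `m ≤ 0` come from the first product, those with `m > 0` from the second.
    rcases le_or_gt m 0 with hm | hm
    · obtain ⟨k, rfl⟩ := Int.exists_eq_neg_ofNat hm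
      exact .inl ⟨k, n, by rw [h]; push_cast; ring⟩
    · obtain ⟨k, hk⟩ := Int.eq_succ_of_zero_lt hm
      exact .inr ⟨k, -n, by rw [h, hk]; push_cast; ring⟩

/-! ### Elliptic functions and powers of theta -/

/-- A function which is entire and doubly periodic is constant. -/
lemma apply_eq_apply_of_periodic {u : ℂ → ℂ} (hu : Differentiable ℂ u) (τ : ℍ)
    (h1 : Function.Periodic u 1) (h2 : Function.Periodic u (τ : ℂ)) (z w : ℂ) : u z = u w := by
  refine hu.apply_eq_apply_of_bounded ?_ z w
  have hK : IsCompact ((fun x : ℝ × ℝ => (x.1 : ℂ) * (τ : ℂ) + x.2) ''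
      (Set.Icc 0 1 ×ˢ Set.Icc 0 1)) :=
    (isCompact_Icc.prod isCompact_Icc).image (by fun_prop)
  refine (hK.image hu.continuous).isBounded.subset ?_
  rintro _ ⟨α, rfl⟩
  have hi : τ.im ≠ 0 := τ.im_ne_zero
  obtain ⟨x, y, rfl⟩ : ∃ x y : ℝ, α = (x : ℂ) * (τ : ℂ) + y :=
    ⟨α.im / τ.im, α.re - α.im / τ.im * τ.re, by
      apply Complex.ext
      · simp
      · simp [hi]⟩
  refine ⟨_, ⟨(Int.fract x, Int.fract y), ⟨⟨Int.fract_nonneg _, (Int.fract_lt_one _).le⟩,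
    ⟨Int.fract_nonneg _, (Int.fract_lt_one _).le⟩⟩, rfl⟩, ?_⟩
  have := ((h2.int_mul ⌊x⌋).add_period (h1.int_mul ⌊y⌋))
    (((Int.fract x : ℝ) : ℂ) * (τ : ℂ) + (Int.fract y : ℝ))
  simp only
  rw [← this]
  congr 1
  have ex : (x : ℂ) = (⌊x⌋ : ℂ) + ((Int.fract x : ℝ) : ℂ) := by
    exact_mod_cast (Int.floor_add_fract x).symm
  have ey : (y : ℂ) = (⌊y⌋ : ℂ) + ((Int.fract y : ℝ) : ℂ) := by
    exact_mod_cast (Int.floor_add_fract y).symm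
  rw [ex, ey]
  simp
  ring

lemma add_int_mem_lattice (τ : ℍ) (α : ℂ) (m n : ℤ) :
    α + m * τ + n ∈ lattice τ ↔ α ∈ lattice τ := by
  constructor
  · rintro ⟨a, b, h⟩
    exact ⟨a - m, b - n, by push_cast; linear_combination h⟩
  · rintro ⟨a, b, h⟩
    exact ⟨a + m, b + n, by push_cast; linear_combination h⟩

lemma zero_mem_lattice (τ : ℍ) : (0 : ℂ) ∈ lattice τ := ⟨0, 0, by simp⟩

lemma differentiable_thetaQuot (τ : ℍ) : Differentiable ℂ (thetaQuot (nome τ)) := fun α =>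
  (analyticOnNhd_thetaQuot (nome τ, α) (norm_nome_lt_one τ.2)).differentiableAt.comp
    (f := fun w => (nome τ, w)) α (by fun_prop)

lemma differentiable_theta (τ : ℍ) : Differentiable ℂ (theta (nome τ)) :=
  differentiable_id.mul (differentiable_thetaQuot τ)

/-- An entire function with the transformation behaviour of `theta ^ N` and a zero of order at
least `N` at the origin is a multiple of `theta ^ N`. -/
theorem exists_eq_const_mul_theta_pow (τ : ℍ) (N : ℕ) {f : ℂ → ℂ} (hf : Differentiable ℂ f)
    (h1 : ∀ α, f (α + 1) = (-1) ^ N * f α)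
    (h2 : ∀ α, f (α + τ) = (-cexp (-(Real.pi * I * (τ + 2 * α)))) ^ N * f α)
    (h0 : N ≤ analyticOrderAt f 0) : ∃ c : ℂ, ∀ α, f α = c * theta (nome τ) α ^ N := by
  classical
  obtain ⟨g, hg, hfg⟩ := (natCast_le_analyticOrderAt (hf.analyticAt 0)).1 h0
  simp only [sub_zero, smul_eq_mul] at hfg
  -- The quotient with its removable singularities filled in: near the origin it is `g / thetaQuot ^
  -- N`, and `thetaQuot` is 1 there. Periodicity carries this to every lattice point.
  set u : ℂ → ℂ := fun α => if α ∈ lattice τ then g 0 else f α / theta (nome τ) α ^ N with hu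
  have hm1 (α : ℂ) : α + 1 ∈ lattice τ ↔ α ∈ lattice τ := by
    simpa using add_int_mem_lattice τ α 0 1
  have hm2 (α : ℂ) : α + τ ∈ lattice τ ↔ α ∈ lattice τ := by
    simpa using add_int_mem_lattice τ α 1 0
  have hp1 : Function.Periodic u 1 := fun α => by
    simp only [hu, hm1, h1, theta_add_one (norm_nome_lt_one τ.2), neg_pow (theta _ _)]
    rw [mul_div_mul_left _ _ (by simp)]
  have hp2 : Function.Periodic u (τ : ℂ) := fun α => by
    simp only [hu, hm2, h2, theta_add_tau, mul_pow]
    rw [mul_div_mul_left _ _ (pow_ne_zero _ (neg_ne_zero.2 (Complex.exp_ne_zero _)))]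
  have hq0 : thetaQuot (nome τ) 0 = 1 := thetaQuot_zero (norm_nome_lt_one τ.2)
  have hqne : ∀ᶠ α in 𝓝 0, thetaQuot (nome τ) α ≠ 0 :=
    (differentiable_thetaQuot τ).continuous.continuousAt.eventually_ne (by simp [hq0])
  have hu0 : u =ᶠ[𝓝 0] fun α => g α / thetaQuot (nome τ) α ^ N := by
    filter_upwards [hqne, hfg] with α h3 h4
    rcases eq_or_ne α 0 with rfl | hα
    · simp [hu, zero_mem_lattice, hq0]
    · have : α ∉ lattice τ := by
        rw [← theta_eq_zero_iff, theta, mul_eq_zero, not_or]; exact ⟨hα, h3⟩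
      simp only [hu, this, if_false, h4, theta, mul_pow]
      rw [mul_div_mul_left _ _ (pow_ne_zero _ hα)]
  have hd0 : DifferentiableAt ℂ u 0 := by
    refine DifferentiableAt.congr_of_eventuallyEq ?_ hu0
    exact hg.differentiableAt.div ((differentiable_thetaQuot τ 0).pow N) (by simp [hq0])
  have hud : Differentiable ℂ u := fun α => by
    by_cases hα : α ∈ lattice τ
    · obtain ⟨m, n, rfl⟩ := hα
      have hp := (hp2.int_mul m).add_period (hp1.int_mul n)
      have : u = fun z => u (z - (m * τ + n)) := by
        ext z
        have := hp (z - (m * τ + n))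
        rw [← this]; congr 1; ring
      rw [this]
      have hs : DifferentiableAt ℂ (fun z : ℂ => z - (m * τ + n)) (m * τ + n) := by fun_prop
      exact DifferentiableAt.comp (g := u) _ (by simpa using hd0) hs
    · have hne : theta (nome τ) α ≠ 0 := fun h => hα ((theta_eq_zero_iff τ α).1 h)
      have hev := (differentiable_theta τ).continuous.continuousAt.eventually_ne hne
      refine DifferentiableAt.congr_of_eventuallyEq
        (f := fun α => f α / theta (nome τ) α ^ N) ?_ ?_
      · exact (hf α).div ((differentiable_theta τ α).pow N) (pow_ne_zero _ hne)
      · filter_upwards [hev] with z hz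
        have : z ∉ lattice τ := fun h => hz ((theta_eq_zero_iff τ z).2 h)
        simp [hu, this]
  refine ⟨g 0, fun α => ?_⟩
  -- The identity is checked near the origin and continued analytically, which covers the lattice
  -- points as well.
  have hA : AnalyticOnNhd ℂ f Set.univ := fun z _ => hf.analyticAt z
  have hB : AnalyticOnNhd ℂ (fun α => g 0 * theta (nome τ) α ^ N) Set.univ := fun z _ =>
    analyticAt_const.mul (((differentiable_theta τ).analyticAt z).pow N)
  refine congrFun (hA.eq_of_eventuallyEq (z₀ := 0) hB ?_) α
  filter_upwards [hu0, hqne, hfg] with z h3 h4 h5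
  have hc : u z = g 0 := by
    rw [apply_eq_apply_of_periodic hud τ hp1 hp2 z 0]
    simp [hu, zero_mem_lattice]
  rw [hc, eq_div_iff (pow_ne_zero _ h4)] at h3
  rw [h5, theta, mul_pow, ← h3]
  ring

/-! ### Taylor coefficients of weak Jacobi forms as modular forms -/

/-- Iterated derivatives in the last variable of an analytic function are analytic. -/
lemma analyticOnNhd_iteratedDeriv_snd {E : Type*} [NormedAddCommGroup E] [NormedSpace ℂ E]
    {F : E × ℂ → ℂ} {U : Set (E × ℂ)} (hU : IsOpen U) (hF : AnalyticOnNhd ℂ F U) (n : ℕ) :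
    AnalyticOnNhd ℂ (fun p : E × ℂ => iteratedDeriv n (fun w => F (p.1, w)) p.2) U := by
  induction n with
  | zero => simpa using hF
  | succ n ih =>
    intro p hp
    have h1 : AnalyticAt ℂ (fun p : E × ℂ =>
        fderiv ℂ (fun p : E × ℂ => iteratedDeriv n (fun w => F (p.1, w)) p.2) p (0, 1)) p :=
      ((ContinuousLinearMap.apply ℂ ℂ ((0, 1) : E × ℂ)).analyticAt _).comp (ih p hp).fderiv
    refine h1.congr ?_
    filter_upwards [hU.mem_nhds hp] with x hx
    rw [iteratedDeriv_succ]
    have h2 : HasDerivAt (fun w : ℂ => ((x.1, w) : E × ℂ)) (0, 1) x.2 :=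
      (hasDerivAt_const _ _).prodMk (hasDerivAt_id _)
    exact (((ih x hx).differentiableAt.hasFDerivAt (x := x)).comp_hasDerivAt x.2 h2).deriv.symm

lemma factor_eq_denom (γ : SL(2, ℤ)) (τ : ℍ) : factor γ τ = denom γ τ := by
  simp [factor, denom]

lemma factor_ne_zero (γ : SL(2, ℤ)) (τ : ℍ) : factor γ τ ≠ 0 := by
  rw [factor_eq_denom]; exact denom_ne_zero _ _

namespace IsWeakJacobiForm

variable {k : ℤ} {N : ℕ} {φ : ℍ → ℂ → ℂ}

lemma isOpen_im_fst_pos : IsOpen {p : ℂ × ℂ | 0 < p.1.im} :=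
  isOpen_lt (by fun_prop) (by fun_prop)

lemma analyticOnNhd (hφ : IsWeakJacobiForm k N φ) :
    AnalyticOnNhd ℂ (fun p : ℂ × ℂ => φ (ofComplex p.1) p.2) {p | 0 < p.1.im} :=
  analyticOnNhd_of_differentiableOn isOpen_im_fst_pos hφ.holomorphic

lemma differentiable (hφ : IsWeakJacobiForm k N φ) (τ : ℍ) : Differentiable ℂ (φ τ) := fun α => by
  have := (hφ.analyticOnNhd ((τ : ℂ), α) τ.2).differentiableAt.comp
    (f := fun w => ((τ : ℂ), w)) α (by fun_prop)
  simpa [Function.comp_def] using this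

/-- A weak Jacobi form is bounded for `Im τ ≥ 1` and `|Im α| ≤ 1`. -/
lemma exists_bound (hφ : IsWeakJacobiForm k N φ) :
    ∃ M : ℝ, ∀ (τ : ℍ) (α : ℂ), 1 ≤ τ.im → |α.im| ≤ 1 → ‖φ τ α‖ ≤ M := by
  obtain ⟨c, hc⟩ := hφ.fourier
  -- The Fourier series at `τ = i`, `α = ±i` together dominate: `|q|` is largest at `Im τ = 1`, and
  -- `|y^x| ≤ e^{2π|x|}` is bounded by the sum of the two values.
  have h1 := (hc UpperHalfPlane.I I).summable.norm
  have h2 := (hc UpperHalfPlane.I (-I)).summable.norm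
  refine ⟨_, fun τ α hτ hα => (hc τ α).tsum_eq ▸ tsum_of_norm_bounded (h1.add h2).hasSum
    (fun p => ?_)⟩
  simp only [norm_mul, norm_pow, Complex.norm_exp, ← mul_add]
  set x : ℝ := (p.2 : ℝ) + N / 2 with hx
  have e0 (w : ℂ) : (2 * Real.pi * I * w * ((p.2 : ℂ) + N / 2)).re = -(2 * Real.pi * w.im * x) := by
    have : ((p.2 : ℂ) + N / 2) = (x : ℂ) := by push_cast [hx]; rfl
    rw [this]; simp
  have e1 (w : ℂ) : (2 * Real.pi * I * w).re = -(2 * Real.pi * w.im) := by simp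
  simp only [e0, e1]
  have hpi := Real.pi_pos
  have hq : Real.exp (-(2 * Real.pi * (τ : ℂ).im)) ≤
      Real.exp (-(2 * Real.pi * (UpperHalfPlane.I : ℂ).im)) := by
    have : (1 : ℝ) ≤ (τ : ℂ).im := hτ
    apply Real.exp_le_exp.2
    simp
    nlinarith
  have hy : Real.exp (-(2 * Real.pi * α.im * x)) ≤
      Real.exp (-(2 * Real.pi * I.im * x)) + Real.exp (-(2 * Real.pi * (-I).im * x)) := by
    have hb : |α.im * x| ≤ |x| := by
      rw [abs_mul]; exact mul_le_of_le_one_left (abs_nonneg _) hα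
    have hb' := neg_le_of_abs_le hb
    rcases le_total 0 x with h0 | h0
    · rw [abs_of_nonneg h0] at hb'
      refine le_add_of_nonneg_of_le (Real.exp_pos _).le (Real.exp_le_exp.2 ?_)
      simp; nlinarith
    · rw [abs_of_nonpos h0] at hb'
      refine le_add_of_le_of_nonneg (Real.exp_le_exp.2 ?_) (Real.exp_pos _).le
      simp; nlinarith
  gcongr

/-- Cauchy's estimate on the unit circle, where `|Im α| ≤ 1`. -/
lemma exists_bound_iteratedDeriv (hφ : IsWeakJacobiForm k N φ) (n : ℕ) :
    ∃ M : ℝ, ∀ τ : ℍ, 1 ≤ τ.im → ‖iteratedDeriv n (φ τ) 0‖ ≤ M := by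
  obtain ⟨M, hM⟩ := hφ.exists_bound
  refine ⟨n.factorial * M / 1 ^ n, fun τ hτ => ?_⟩
  refine norm_iteratedDeriv_le_of_forall_mem_sphere_norm_le n one_pos
    (hφ.differentiable τ).diffContOnCl (fun z hz => hM τ z hτ ?_)
  exact (Complex.abs_im_le_norm z).trans (by simpa using hz.le)

/-- The lowest Taylor coefficient in `α` of a weak Jacobi form transforms like a modular form. -/
lemma iteratedDeriv_modular (hφ : IsWeakJacobiForm k N φ) (n : ℕ)
    (h0 : ∀ τ : ℍ, ∀ i < n, iteratedDeriv i (φ τ) 0 = 0) (γ : SL(2, ℤ)) (τ : ℍ) :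
    iteratedDeriv n (φ (γ • τ)) 0 = factor γ τ ^ (k + n) * iteratedDeriv n (φ τ) 0 := by
  have hj := factor_ne_zero γ τ
  set j := factor γ τ with hjd
  set e : ℂ → ℂ := fun α => j ^ k *
    cexp (2 * Real.pi * I * ((N : ℂ) / 2) * (((γ 1 0 : ℤ) : ℂ) * (j * α) ^ 2 / j)) with he
  have hfun : φ (γ • τ) = e * fun α => φ τ (j * α) := by
    ext α
    have := hφ.modular γ τ (j * α)
    rw [← hjd, mul_div_cancel_left₀ _ hj] at this
    simpa [he] using this
  have hcd : ContDiff ℂ n (φ τ) := (hφ.differentiable τ).contDiff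
  have hed : ContDiff ℂ n e := by
    have : Differentiable ℂ e := by simp only [he]; fun_prop
    exact this.contDiff
  have hsc : ContDiff ℂ n (fun α => φ τ (j * α)) := hcd.comp (contDiff_const.mul contDiff_id)
  rw [hfun, iteratedDeriv_mul hed.contDiffAt hsc.contDiffAt,
    Finset.sum_range_succ']
  have h1 (i : ℕ) (hi : i ≤ n) : iteratedDeriv i (fun α => φ τ (j * α)) 0 =
      j ^ i * iteratedDeriv i (φ τ) 0 := by
    rw [iteratedDeriv_comp_const_mul (hcd.of_le (by exact_mod_cast hi))]; simp
  -- Every Leibniz term that differentiates `e` contains a derivative of `φ` of order below `n`,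
  -- which vanishes at 0.
  rw [Finset.sum_eq_zero (fun i hi => ?_)]
  · rw [Nat.sub_zero, h1 n le_rfl]
    simp [he, zpow_add₀ hj]
    ring
  · have hi' : i < n := Finset.mem_range.1 hi
    rw [h1 _ (Nat.sub_le _ _), h0 τ _ (by omega)]
    simp

open scoped ModularForm in
lemma iteratedDeriv_slash (hφ : IsWeakJacobiForm k N φ) (n : ℕ)
    (h0 : ∀ τ : ℍ, ∀ i < n, iteratedDeriv i (φ τ) 0 = 0) (γ : SL(2, ℤ)) :
    (fun τ => iteratedDeriv n (φ τ) 0) ∣[k + n] γ = fun τ => iteratedDeriv n (φ τ) 0 := by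
  ext τ
  rw [ModularForm.SL_slash_apply, hφ.iteratedDeriv_modular n h0, factor_eq_denom, mul_right_comm,
    ← zpow_add₀ (denom_ne_zero _ _)]
  simp

/-- The lowest Taylor coefficient in `α` of a weak Jacobi form, as a modular form. -/
noncomputable def lowestCoefficient (hφ : IsWeakJacobiForm k N φ) (n : ℕ)
    (h0 : ∀ τ : ℍ, ∀ i < n, iteratedDeriv i (φ τ) 0 = 0) : ModularForm 𝒮ℒ (k + n) where
  toFun τ := iteratedDeriv n (φ τ) 0
  slash_action_eq' := by
    rintro _ ⟨γ, rfl⟩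
    exact hφ.iteratedDeriv_slash n h0 γ
  holo' := by
    rw [mdifferentiable_iff]
    intro z hz
    have := (analyticOnNhd_iteratedDeriv_snd isOpen_im_fst_pos hφ.analyticOnNhd n
      (z, 0) hz).differentiableAt.comp (f := fun z : ℂ => (z, (0 : ℂ))) z (by fun_prop)
    exact this.differentiableWithinAt
  bdd_at_cusps' := fun {c} hc => by
    -- Every cusp is equivalent to infinity, so slash invariance reduces boundedness to the estimate
    -- for `Im τ ≥ 1`.
    rw [OnePoint.isBoundedAt_iff_exists_SL2Z hc]
    obtain ⟨γ, hγ⟩ := isCusp_SL2Z_iff'.1 hc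
    refine ⟨γ, hγ.symm, ?_⟩
    rw [hφ.iteratedDeriv_slash n h0, isBoundedAtImInfty_iff]
    obtain ⟨M, hM⟩ := hφ.exists_bound_iteratedDeriv n
    exact ⟨M, 1, hM⟩

/-- The Taylor coefficients in `α` of order `< N` of a weak Jacobi form of weight `-N` vanish. -/
lemma iteratedDeriv_eq_zero (hφ : IsWeakJacobiForm (-(N : ℤ)) N φ) (n : ℕ) (hn : n < N) (τ : ℍ) :
    iteratedDeriv n (φ τ) 0 = 0 := by
  induction n using Nat.strong_induction_on generalizing τ with
  | _ n ih =>
    have h := ModularFormClass.levelOne_neg_weight_eq_zero (k := -(N : ℤ) + n) (by omega)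
      (hφ.lowestCoefficient n (fun τ i hi => ih i hi (hi.trans hn) τ))
    exact congrFun h τ

lemma exists_iteratedDeriv_eq (hφ : IsWeakJacobiForm (-(N : ℤ)) N φ) :
    ∃ c : ℂ, ∀ τ, iteratedDeriv N (φ τ) 0 = c := by
  -- The weight `-N + N` sits in the type and is zero only propositionally, hence the general `k`.
  have key : ∀ {k : ℤ} (_ : k = 0) (f : ModularForm 𝒮ℒ k), ∃ c, ⇑f = Function.const _ c := by
    rintro k rfl f
    exact ModularFormClass.levelOne_weight_zero_const f
  obtain ⟨c, hc⟩ := key (k := -(N : ℤ) + N) (by omega)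
    (hφ.lowestCoefficient N (fun τ i hi => hφ.iteratedDeriv_eq_zero i hi τ))
  exact ⟨c, fun τ => congrFun hc τ⟩

lemma exists_eq_const_mul_theta_pow (hφ : IsWeakJacobiForm (-(N : ℤ)) N φ) (τ : ℍ) :
    ∃ c : ℂ, ∀ α, φ τ α = c * theta (nome τ) α ^ N := by
  refine JacobiForms.exists_eq_const_mul_theta_pow τ N (hφ.differentiable τ) (fun α => ?_)
    (fun α => ?_) ?_
  · simpa using hφ.translate τ α 0 1
  · have := hφ.translate τ α 1 0
    simp only [Int.cast_one, one_mul, Int.cast_zero, add_zero, mul_one, zpow_natCast] at this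
    rw [this, neg_pow (cexp _), ← Complex.exp_nat_mul]
    congr 3
    ring
  · exact (natCast_le_analyticOrderAt_iff_iteratedDeriv_eq_zero
      ((hφ.differentiable τ).analyticAt 0)).2 (fun i hi => hφ.iteratedDeriv_eq_zero i hi τ)

end IsWeakJacobiForm

/-! ### Rigidity: the form is a constant times a power of theta -/

lemma iteratedDeriv_pow_mul {g : ℂ → ℂ} (hg : AnalyticAt ℂ g 0) (n : ℕ) :
    iteratedDeriv n (fun α => α ^ n * g α) 0 = n.factorial * g 0 := by
  have := iteratedDeriv_mul (n := n) (f := fun α : ℂ => α ^ n) (x := (0 : ℂ))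
    (contDiff_id.pow n).contDiffAt hg.contDiffAt
  rw [show (fun α => α ^ n * g α) = (fun α : ℂ => α ^ n) * g from rfl, this,
    Finset.sum_range_succ, Finset.sum_eq_zero (fun i hi => ?_)]
  · simp [Nat.descFactorial_self]
  · have hi' : i < n := Finset.mem_range.1 hi
    simp [zero_pow (Nat.sub_ne_zero_of_lt hi')]

/-- A nonzero weak Jacobi form of weight `-N` and index `N / 2` is a constant multiple of the
`N`-th power of the normalized theta function. -/
theorem IsWeakJacobiForm.eq_const_mul {N : ℕ} {φ : ℍ → ℂ → ℂ}
    (hφ : IsWeakJacobiForm (-(N : ℤ)) N φ) (hne : ∃ (τ : ℍ) (α : ℂ), φ τ α ≠ 0) :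
    ∃ c : ℂ, c ≠ 0 ∧ (∀ τ α, φ τ α = c * (α ^ N * thetaQuot (nome τ) α ^ N)) ∧
      ∀ τ, iteratedDeriv N (φ τ) 0 = N.factorial * c := by
  choose c hc using hφ.exists_eq_const_mul_theta_pow
  have hfac : (N.factorial : ℂ) ≠ 0 := by exact_mod_cast N.factorial_ne_zero
  have hd (τ : ℍ) : iteratedDeriv N (φ τ) 0 = N.factorial * c τ := by
    have : φ τ = fun α => α ^ N * (c τ * thetaQuot (nome τ) α ^ N) := by
      ext α; rw [hc, theta, mul_pow]; ring
    have hg : AnalyticAt ℂ (fun α => c τ * thetaQuot (nome τ) α ^ N) 0 :=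
      analyticAt_const.mul (((differentiable_thetaQuot τ).analyticAt 0).pow N)
    rw [this, iteratedDeriv_pow_mul hg,
      thetaQuot_zero (norm_nome_lt_one τ.2)]
    simp
  obtain ⟨C, hC⟩ := hφ.exists_iteratedDeriv_eq
  have hcC (τ : ℍ) : c τ = C / N.factorial := by
    rw [eq_div_iff hfac, mul_comm, ← hd, hC]
  refine ⟨C / N.factorial, ?_, fun τ α => ?_, fun τ => ?_⟩
  · obtain ⟨τ, α, h⟩ := hne
    rw [← hcC τ]
    intro h0
    simp [hc, h0] at h
  · rw [hc, hcC, theta, mul_pow]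
  · rw [hd, hcC]

/-! ### Rescaling, and the transformation laws of λ -/

lemma iteratedDeriv_comp_mul_left (f : ℂ → ℂ) (a : ℂ) (n : ℕ) :
    iteratedDeriv n (fun t => f (a * t)) = fun t => a ^ n * iteratedDeriv n f (a * t) := by
  induction n with
  | zero => simp
  | succ n ih =>
    ext t
    rw [iteratedDeriv_succ, ih, deriv_const_mul_field, deriv_comp_mul_left a (iteratedDeriv n f) t,
      ← iteratedDeriv_succ, smul_eq_mul]
    ring

lemma coe_sub_conj_ne_zero (τ : ℍ) : (τ : ℂ) - starRingEnd ℂ (τ : ℂ) ≠ 0 := by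
  rw [Complex.sub_conj]
  simpa using τ.im_ne_zero

lemma lam_add (τ : ℍ) (α : ℂ) (m n : ℤ) : lam τ (α + m * τ + n) = lam τ α + m := by
  have := coe_sub_conj_ne_zero τ
  simp only [lam, map_add, map_mul, map_intCast]
  field_simp
  ring

lemma coe_smul_eq (γ : SL(2, ℤ)) (τ : ℍ) :
    ((γ • τ : ℍ) : ℂ) = (((γ 0 0 : ℤ) : ℂ) * τ + ((γ 0 1 : ℤ) : ℂ)) / factor γ τ := by
  rw [coe_specialLinearGroup_apply]
  simp [factor]

lemma mem_lattice_of_div_factor_mem (γ : SL(2, ℤ)) (τ : ℍ) {α : ℂ}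
    (h : α / factor γ τ ∈ lattice (γ • τ)) : α ∈ lattice τ := by
  have hj := factor_ne_zero γ τ
  obtain ⟨m, n, h⟩ := h
  rw [coe_smul_eq, div_eq_iff hj, add_mul, mul_assoc, div_mul_cancel₀ _ hj, factor] at h
  exact ⟨m * γ 0 0 + n * γ 1 0, m * γ 0 1 + n * γ 1 1, by push_cast; linear_combination h⟩

/-- With `j = cτ + d`, the denominator is divided by `j j̄`, and `j̄ = j - c (τ - τ̄)` turns `α j̄ -
ᾱ j` into `j (α - ᾱ) - c α (τ - τ̄)`. -/
lemma lam_modular (γ : SL(2, ℤ)) (τ : ℍ) (α : ℂ) :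
    lam (γ • τ) (α / factor γ τ) = factor γ τ * lam τ α - ((γ 1 0 : ℤ) : ℂ) * α := by
  have hτ := coe_sub_conj_ne_zero τ
  have hj := factor_ne_zero γ τ
  have hj' : starRingEnd ℂ (factor γ τ) ≠ 0 := (map_ne_zero _).2 hj
  have hdet : ((γ 0 0 : ℤ) : ℂ) * ((γ 1 1 : ℤ) : ℂ) -
      ((γ 0 1 : ℤ) : ℂ) * ((γ 1 0 : ℤ) : ℂ) = 1 := by
    have := γ.det_coe
    rw [Matrix.det_fin_two] at this
    exact_mod_cast this
  have hd : ((γ • τ : ℍ) : ℂ) - starRingEnd ℂ ((γ • τ : ℍ) : ℂ) =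
      ((τ : ℂ) - starRingEnd ℂ (τ : ℂ)) / (factor γ τ * starRingEnd ℂ (factor γ τ)) := by
    rw [coe_smul_eq, map_div₀, div_sub_div _ _ hj hj']
    congr 1
    simp only [factor, map_add, map_mul, map_intCast]
    linear_combination ((τ : ℂ) - starRingEnd ℂ (τ : ℂ)) * hdet
  rw [lam, hd, lam, map_div₀]
  field_simp
  simp only [factor, map_add, map_mul, map_intCast]
  ring

/-! ### The normalized quotient and its Taylor coefficients -/

/-- The function `(θ(q, t + α) t / θ(q, t)) ^ N`, with `θ` normalized to have derivative one. -/
noncomputable def shiftQuot (N : ℕ) (q α t : ℂ) : ℂ := (theta q (t + α) / thetaQuot q t) ^ N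

/-- The function `(θ(q, t + α) t / (θ(q, t) θ(q, α))) ^ N`. -/
noncomputable def shiftRatio (N : ℕ) (q α t : ℂ) : ℂ := (theta q α ^ N)⁻¹ * shiftQuot N q α t

/-- The Taylor coefficients in `t` of `shiftRatio`. -/
noncomputable def taylorCoeff (N i : ℕ) (τ : ℍ) (α : ℂ) : ℂ :=
  iteratedDeriv i (shiftRatio N (nome τ) α) 0 / i.factorial

lemma analyticOnNhd_theta :
    AnalyticOnNhd ℂ (fun p : ℂ × ℂ => theta p.1 p.2) {p | ‖p.1‖ < 1} := fun p hp =>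
  analyticAt_snd.mul (analyticOnNhd_thetaQuot p hp)

lemma analyticAt_shiftQuot (N : ℕ) {q : ℂ} (hq : ‖q‖ < 1) (α : ℂ) {t : ℂ} (ht : thetaQuot q t ≠ 0) :
    AnalyticAt ℂ (fun p : (ℂ × ℂ) × ℂ => shiftQuot N p.1.1 p.1.2 p.2) ((q, α), t) := by
  have h1 : AnalyticAt ℂ (fun p : (ℂ × ℂ) × ℂ => p.1.1) ((q, α), t) :=
    analyticAt_fst.comp analyticAt_fst
  have h2 : AnalyticAt ℂ (fun p : (ℂ × ℂ) × ℂ => p.1.2) ((q, α), t) :=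
    analyticAt_snd.comp analyticAt_fst
  have h3 : AnalyticAt ℂ (fun p : (ℂ × ℂ) × ℂ => theta p.1.1 (p.2 + p.1.2)) ((q, α), t) :=
    (analyticOnNhd_theta (q, t + α) hq).comp
      (f := fun p : (ℂ × ℂ) × ℂ => (p.1.1, p.2 + p.1.2)) (x := ((q, α), t))
      (h1.prod (analyticAt_snd.add h2))
  have h4 : AnalyticAt ℂ (fun p : (ℂ × ℂ) × ℂ => thetaQuot p.1.1 p.2) ((q, α), t) :=
    (analyticOnNhd_thetaQuot (q, t) hq).comp
      (f := fun p : (ℂ × ℂ) × ℂ => (p.1.1, p.2)) (x := ((q, α), t)) (h1.prod analyticAt_snd)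
  exact (h3.div h4 ht).pow N

lemma analyticAt_shiftRatio (N : ℕ) {q : ℂ} (hq : ‖q‖ < 1) (α : ℂ) :
    AnalyticAt ℂ (shiftRatio N q α) 0 := by
  have h := analyticAt_shiftQuot N hq α (t := 0) (by simp [thetaQuot_zero hq])
  exact analyticAt_const.mul (h.comp (f := fun t : ℂ => ((q, α), t)) (x := 0)
    (analyticAt_const.prod analyticAt_id))

lemma shiftRatio_zero (N : ℕ) (τ : ℍ) {α : ℂ} (hα : α ∉ lattice τ) :
    shiftRatio N (nome τ) α 0 = 1 := by
  have : theta (nome τ) α ≠ 0 := fun h => hα ((theta_eq_zero_iff τ α).1 h)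
  simp [shiftRatio, shiftQuot, thetaQuot_zero (norm_nome_lt_one τ.2), this]

lemma taylorCoeff_zero (N : ℕ) (τ : ℍ) {α : ℂ} (hα : α ∉ lattice τ) :
    taylorCoeff N 0 τ α = 1 := by
  simp [taylorCoeff, shiftRatio_zero N τ hα]

lemma eventually_hasSum_shiftRatio (N : ℕ) (τ : ℍ) (α : ℂ) :
    ∀ᶠ t in 𝓝 0, HasSum (fun i => taylorCoeff N i τ α * t ^ i) (shiftRatio N (nome τ) α t) := by
  have h := (analyticAt_shiftRatio N (norm_nome_lt_one τ.2) α).hasFPowerSeriesAt.eventually_hasSum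
  filter_upwards [h] with t ht
  simpa [FormalMultilinearSeries.ofScalars, taylorCoeff, mul_comm] using ht

/-- `shiftQuot` is jointly analytic in `(q, α, t)` wherever `thetaQuot q t` is nonzero, in
particular near `t = 0`. Since `q = 0` is allowed, this also serves at the cusp. -/
lemma analyticOnNhd_iteratedDeriv_shiftQuot (N i : ℕ) :
    AnalyticOnNhd ℂ (fun p : ℂ × ℂ => iteratedDeriv i (shiftQuot N p.1 p.2) 0) {p | ‖p.1‖ < 1} := by
  intro p hp
  set U : Set ((ℂ × ℂ) × ℂ) := {x | ‖x.1.1‖ < 1} ∩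
    (fun x : (ℂ × ℂ) × ℂ => thetaQuot x.1.1 x.2) ⁻¹' {0}ᶜ
  have hU : IsOpen U := by
    refine ContinuousOn.isOpen_inter_preimage ?_ (isOpen_lt (by fun_prop) (by fun_prop))
      isOpen_compl_singleton
    exact analyticOnNhd_thetaQuot.continuousOn.comp
      (f := fun x : (ℂ × ℂ) × ℂ => (x.1.1, x.2)) (by fun_prop) (fun x hx => hx)
  have h := analyticOnNhd_iteratedDeriv_snd hU
    (F := fun p : (ℂ × ℂ) × ℂ => shiftQuot N p.1.1 p.1.2 p.2)
    (fun x hx => analyticAt_shiftQuot N hx.1 x.1.2 hx.2) i (p, 0)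
    ⟨hp, by simp [thetaQuot_zero hp]⟩
  exact h.comp (f := fun p : ℂ × ℂ => (p, (0 : ℂ))) (analyticAt_id.prod analyticAt_const)

lemma taylorCoeff_eq (N i : ℕ) (τ : ℍ) (α : ℂ) : taylorCoeff N i τ α =
    iteratedDeriv i (shiftQuot N (nome τ) α) 0 / (i.factorial * theta (nome τ) α ^ N) := by
  rw [taylorCoeff, show shiftRatio N (nome τ) α = fun t => (theta (nome τ) α ^ N)⁻¹ *
    shiftQuot N (nome τ) α t from rfl, iteratedDeriv_const_mul_field, inv_mul_eq_div, div_div,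
    mul_comm (theta _ _ ^ N)]

lemma IsCoefficient.const_mul {f : ℍ → ℂ → ℂ} (hf : IsCoefficient f) (a : ℂ) :
    IsCoefficient (fun τ α => a * f τ α) where
  holomorphic := hf.holomorphic.const_mul a
  meromorphic τ₀ m n := by
    obtain ⟨k, g, hg, h⟩ := hf.meromorphic τ₀ m n
    refine ⟨k, fun p => a * g p, analyticAt_const.mul hg, ?_⟩
    filter_upwards [h] with p hp hl
    simp only [← hp hl]; ring
  cusp := by
    obtain ⟨k, g, ε, hε, hg, h⟩ := hf.cusp
    refine ⟨k, fun p => a * g p, ε, hε, analyticAt_const.mul hg, fun τ α h1 h2 h3 => ?_⟩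
    simp only [← h τ α h1 h2 h3]; ring

/-! ### Completion by an exponential in λ -/

/-- The completion of `shiftRatio`: it is doubly periodic in `α` and modular invariant. -/
noncomputable def completedRatio (N : ℕ) (τ : ℍ) (α t : ℂ) : ℂ :=
  cexp (2 * Real.pi * I * N * lam τ α * t) * shiftRatio N (nome τ) α t

/-- The coefficients of the completion of `taylorCoeff N i` as a polynomial in `lam`. -/
noncomputable def completionCoeff (N i j : ℕ) (_l : ℕ) (τ : ℍ) (α : ℂ) : ℂ :=
  (2 * Real.pi * I * N) ^ j / j.factorial * taylorCoeff N (i - j) τ α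

/-- Leibniz' rule for the product of `exp(2πi N λ t)` with `shiftRatio`. No power of `μ` occurs,
hence depth 0 in that variable. -/
lemma polyLamMu_completionCoeff (N i : ℕ) (τ : ℍ) (α : ℂ) :
    polyLamMu i 0 (completionCoeff N i) τ α =
      iteratedDeriv i (completedRatio N τ α) 0 / i.factorial := by
  have hfun : completedRatio N τ α = (fun t => cexp (2 * Real.pi * I * N * lam τ α * t)) *
      shiftRatio N (nome τ) α := rfl
  have he : ContDiffAt ℂ i (fun t => cexp (2 * Real.pi * I * N * lam τ α * t)) 0 := by fun_prop
  rw [hfun, iteratedDeriv_mul he (analyticAt_shiftRatio N (norm_nome_lt_one τ.2) α).contDiffAt,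
    Finset.sum_div, polyLamMu]
  refine Finset.sum_congr rfl (fun j hj => ?_)
  have hji : j ≤ i := Nat.lt_succ_iff.1 (Finset.mem_range.1 hj)
  have hc : (i.choose j : ℂ) * (j.factorial * (i - j).factorial) = i.factorial := by
    rw [← mul_assoc]; exact_mod_cast Nat.choose_mul_factorial_mul_factorial hji
  have f1 : (j.factorial : ℂ) ≠ 0 := by exact_mod_cast j.factorial_ne_zero
  have f2 : ((i - j).factorial : ℂ) ≠ 0 := by exact_mod_cast (i - j).factorial_ne_zero
  have f3 : (i.choose j : ℂ) ≠ 0 := by exact_mod_cast (Nat.choose_pos hji).ne'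
  rw [iteratedDeriv_cexp_const_mul, ← hc]
  simp only [zero_add, Finset.range_one, Finset.sum_singleton, pow_zero, mul_one, completionCoeff,
    taylorCoeff, mul_zero, Complex.exp_zero]
  rw [mul_pow _ (lam τ α)]
  field_simp

variable {N : ℕ} {φ : ℍ → ℂ → ℂ} {c : ℂ}

/-- Expresses the quotient through `φ`, whose transformation laws are given. Only `c² t^N` is
cancelled, so the formula holds even where `φ τ t` vanishes, with division by zero on both sides. -/
lemma shiftRatio_eq (hc : c ≠ 0)
    (h : ∀ τ α, φ τ α = c * (α ^ N * thetaQuot (nome τ) α ^ N)) (τ : ℍ) (α : ℂ) {t : ℂ}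
    (ht : t ≠ 0) :
    shiftRatio N (nome τ) α t = c * t ^ N * φ τ (t + α) / (φ τ t * φ τ α) := by
  have e : c * t ^ N * φ τ (t + α) / (φ τ t * φ τ α) =
      (c * c * t ^ N) * theta (nome τ) (t + α) ^ N /
        ((c * c * t ^ N) * (thetaQuot (nome τ) t ^ N * theta (nome τ) α ^ N)) := by
    simp only [h, theta, mul_pow]; congr 1 <;> ring
  rw [e, mul_div_mul_left _ _ (mul_ne_zero (mul_ne_zero hc hc) (pow_ne_zero _ ht)), shiftRatio,
    shiftQuot, div_pow, inv_mul_eq_div, div_div]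

lemma completedRatio_translate (hφ : IsWeakJacobiForm (-(N : ℤ)) N φ) (hc : c ≠ 0)
    (h : ∀ τ α, φ τ α = c * (α ^ N * thetaQuot (nome τ) α ^ N)) (τ : ℍ) {α : ℂ}
    (hα : α ∉ lattice τ) (m n : ℤ) :
    completedRatio N τ (α + m * τ + n) = completedRatio N τ α := by
  ext t
  rcases eq_or_ne t 0 with rfl | ht
  · have hα' : α + m * τ + n ∉ lattice τ := by rwa [add_int_mem_lattice]
    simp [completedRatio, shiftRatio_zero N τ hα, shiftRatio_zero N τ hα']
  · rw [completedRatio, completedRatio, shiftRatio_eq hc h τ _ ht, shiftRatio_eq hc h τ _ ht,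
      lam_add, show t + (α + m * τ + n) = (t + α) + m * τ + n by ring, hφ.translate, hφ.translate]
    have hs : (-1 : ℂ) ^ ((N : ℤ) * (m + n)) ≠ 0 := zpow_ne_zero _ (by norm_num)
    set s := (-1 : ℂ) ^ ((N : ℤ) * (m + n))
    set E := cexp (-(2 * Real.pi * I * ((N : ℂ) / 2) * ((m : ℂ) ^ 2 * τ + 2 * m * α))) with hE
    have hE0 : E ≠ 0 := Complex.exp_ne_zero _
    have e1 : cexp (2 * Real.pi * I * N * (lam τ α + m) * t) *
        cexp (-(2 * Real.pi * I * ((N : ℂ) / 2) * ((m : ℂ) ^ 2 * τ + 2 * m * (t + α)))) =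
        cexp (2 * Real.pi * I * N * lam τ α * t) * E := by
      rw [hE, ← Complex.exp_add, ← Complex.exp_add]; congr 1; ring
    calc _ = (cexp (2 * Real.pi * I * N * (lam τ α + m) * t) *
        cexp (-(2 * Real.pi * I * ((N : ℂ) / 2) * ((m : ℂ) ^ 2 * τ + 2 * m * (t + α))))) *
          (s * (c * t ^ N * φ τ (t + α))) / (s * E * (φ τ t * φ τ α)) := by ring
      _ = (s * E) * (cexp (2 * Real.pi * I * N * lam τ α * t) * (c * t ^ N * φ τ (t + α))) /
          ((s * E) * (φ τ t * φ τ α)) := by rw [e1]; ring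
      _ = _ := by rw [mul_div_mul_left _ _ (mul_ne_zero hs hE0)]; ring

lemma completedRatio_modular (hφ : IsWeakJacobiForm (-(N : ℤ)) N φ) (hc : c ≠ 0)
    (h : ∀ τ α, φ τ α = c * (α ^ N * thetaQuot (nome τ) α ^ N)) (γ : SL(2, ℤ)) (τ : ℍ) {α : ℂ}
    (hα : α ∉ lattice τ) :
    completedRatio N (γ • τ) (α / factor γ τ) =
      fun t => completedRatio N τ α (factor γ τ * t) := by
  have hj := factor_ne_zero γ τ
  have hα' : α / factor γ τ ∉ lattice (γ • τ) := fun hl =>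
    hα (mem_lattice_of_div_factor_mem γ τ hl)
  ext t
  rcases eq_or_ne t 0 with rfl | ht
  · rw [completedRatio, completedRatio, shiftRatio_zero N _ hα', mul_zero, mul_zero, mul_zero,
      shiftRatio_zero N _ hα]
  · rw [completedRatio, completedRatio, shiftRatio_eq hc h _ _ ht,
      shiftRatio_eq hc h τ _ (mul_ne_zero hj ht), lam_modular]
    set j := factor γ τ with hjd
    have ht' : t = j * t / j := by field_simp
    have e1 : t + α / j = (j * t + α) / j := by field_simp
    have m1 := hφ.modular γ τ (j * t)
    have m2 := hφ.modular γ τ α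
    have m3 := hφ.modular γ τ (j * t + α)
    rw [← hjd] at m1 m2 m3
    rw [← ht'] at m1
    rw [e1, m1, m2, m3]
    set d : ℂ := ((γ 1 0 : ℤ) : ℂ)
    set K := 2 * Real.pi * I * ((N : ℂ) / 2) with hK
    have hzp : j ^ (-(N : ℤ)) = (j ^ N)⁻¹ := by simp
    -- The cross term `2 j t α` of `(j t + α)²` is exactly what the shift of `λ` by `-d α` absorbs.
    have e2 : cexp (2 * Real.pi * I * N * (j * lam τ α - d * α) * t) *
        cexp (K * (d * (j * t + α) ^ 2 / j)) = cexp (2 * Real.pi * I * N * lam τ α * (j * t)) *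
          (cexp (K * (d * (j * t) ^ 2 / j)) * cexp (K * (d * α ^ 2 / j))) := by
      simp only [← Complex.exp_add]
      congr 1
      rw [hK]
      field_simp
      ring
    set E1 := cexp (K * (d * (j * t) ^ 2 / j)) with hE1
    set E2 := cexp (K * (d * α ^ 2 / j)) with hE2
    have hE : E1 * E2 ≠ 0 := mul_ne_zero (Complex.exp_ne_zero _) (Complex.exp_ne_zero _)
    have hJ : j ^ N ≠ 0 := pow_ne_zero _ hj
    rw [hzp]
    calc _ = (cexp (2 * Real.pi * I * N * (j * lam τ α - d * α) * t) *
        cexp (K * (d * (j * t + α) ^ 2 / j))) * ((j ^ N)⁻¹ * (c * t ^ N * φ τ (j * t + α))) /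
          ((j ^ N)⁻¹ * (j ^ N)⁻¹ * (E1 * E2) * (φ τ (j * t) * φ τ α)) := by ring
      _ = ((j ^ N)⁻¹ * (j ^ N)⁻¹ * (E1 * E2)) *
          (cexp (2 * Real.pi * I * N * lam τ α * (j * t)) * (c * (j * t) ^ N * φ τ (j * t + α))) /
          (((j ^ N)⁻¹ * (j ^ N)⁻¹ * (E1 * E2)) * (φ τ (j * t) * φ τ α)) := by
        rw [e2, mul_pow]; congr 1; field_simp
      _ = _ := by rw [mul_div_mul_left _ _ 
        (mul_ne_zero (mul_ne_zero (inv_ne_zero hJ) (inv_ne_zero hJ)) hE)]; ring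

/-! ### Poles, behaviour at the cusp, and quasi-Jacobi forms -/

lemma theta_pow_translate (hφ : IsWeakJacobiForm (-(N : ℤ)) N φ) (hc : c ≠ 0)
    (h : ∀ τ α, φ τ α = c * (α ^ N * thetaQuot (nome τ) α ^ N)) (τ : ℍ) (α : ℂ) (m n : ℤ) :
    theta (nome τ) (α + m * τ + n) ^ N = (-1 : ℂ) ^ ((N : ℤ) * (m + n)) *
        cexp (-(2 * Real.pi * I * ((N : ℂ) / 2) * ((m : ℂ) ^ 2 * τ + 2 * m * α))) *
          theta (nome τ) α ^ N := by
  have e (α : ℂ) : φ τ α = c * theta (nome τ) α ^ N := by rw [h, theta, mul_pow]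
  have := hφ.translate τ α m n
  rw [e, e] at this
  refine mul_left_cancel₀ hc (this.trans ?_)
  ring

lemma analyticAt_nome (z : ℂ) : AnalyticAt ℂ nome z := by
  have : Differentiable ℂ nome := by unfold nome; fun_prop
  exact this.analyticAt z

/-- By `taylorCoeff_eq` the only denominator is `theta ^ N`, so poles lie on the lattice and have
order at most `N`. -/
theorem isCoefficient_taylorCoeff (hφ : IsWeakJacobiForm (-(N : ℤ)) N φ) (hc : c ≠ 0)
    (h : ∀ τ α, φ τ α = c * (α ^ N * thetaQuot (nome τ) α ^ N)) (i : ℕ) :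
    IsCoefficient (taylorCoeff N i) where
  holomorphic := by
    rintro p ⟨hp, hl⟩
    have hq := norm_nome_lt_one hp
    have hn : AnalyticAt ℂ (fun p : ℂ × ℂ => (nome p.1, p.2)) p :=
      ((analyticAt_nome p.1).comp analyticAt_fst).prod analyticAt_snd
    have h1 := (analyticOnNhd_iteratedDeriv_shiftQuot N i (nome p.1, p.2) hq).comp
      (f := fun p : ℂ × ℂ => (nome p.1, p.2)) hn
    have h2 := (analyticOnNhd_theta (nome p.1, p.2) hq).comp
      (f := fun p : ℂ × ℂ => (nome p.1, p.2)) hn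
    have hfac : (i.factorial : ℂ) ≠ 0 := by exact_mod_cast i.factorial_ne_zero
    have hth : theta (nome p.1) p.2 ≠ 0 := fun h0 => hl <| by
      rw [← theta_eq_zero_iff, ofComplex_apply_of_im_pos hp]; exact h0
    have h3 := (h1.div (analyticAt_const.mul (h2.pow N))
      (mul_ne_zero hfac (pow_ne_zero N hth))).differentiableAt
    refine (h3.congr_of_eventuallyEq ?_).differentiableWithinAt
    filter_upwards [IsWeakJacobiForm.isOpen_im_fst_pos.mem_nhds hp] with x hx
    rw [taylorCoeff_eq, ofComplex_apply_of_im_pos hx]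
    rfl
  meromorphic τ₀ m n := by
    -- Translation moves the lattice point to the origin: `theta ^ N` is a nonvanishing multiplier
    -- times `(α - mτ - n)^N` times a power of `thetaQuot`, which is 1 at the centre.
    refine ⟨N, fun p => iteratedDeriv i (shiftQuot N (nome p.1) p.2) 0 / (i.factorial *
      ((-1 : ℂ) ^ ((N : ℤ) * (m + n)) * cexp (-(2 * Real.pi * I * ((N : ℂ) / 2) *
        ((m : ℂ) ^ 2 * p.1 + 2 * m * (p.2 - (m * p.1 + n))))) *
          thetaQuot (nome p.1) (p.2 - (m * p.1 + n)) ^ N)), ?_, ?_⟩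
    · set p₀ : ℂ × ℂ := ((τ₀ : ℂ), (m : ℂ) * τ₀ + n) with hp₀
      have hq := norm_nome_lt_one τ₀.2
      have hnome : AnalyticAt ℂ (fun p : ℂ × ℂ => nome p.1) p₀ :=
        (analyticAt_nome p₀.1).comp analyticAt_fst
      have hsub : AnalyticAt ℂ (fun p : ℂ × ℂ => p.2 - (m * p.1 + n)) p₀ :=
        analyticAt_snd.sub ((analyticAt_const.mul analyticAt_fst).add analyticAt_const)
      have h1 := (analyticOnNhd_iteratedDeriv_shiftQuot N i (nome p₀.1, p₀.2) hq).comp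
        (f := fun p : ℂ × ℂ => (nome p.1, p.2)) (hnome.prod analyticAt_snd)
      have h2 := (analyticOnNhd_thetaQuot (nome p₀.1, p₀.2 - (m * p₀.1 + n)) hq).comp
        (f := fun p : ℂ × ℂ => (nome p.1, p.2 - (m * p.1 + n))) (hnome.prod hsub)
      have hE : AnalyticAt ℂ (fun p : ℂ × ℂ => cexp (-(2 * Real.pi * I * ((N : ℂ) / 2) *
          ((m : ℂ) ^ 2 * p.1 + 2 * m * (p.2 - (m * p.1 + n)))))) p₀ :=
        (analyticAt_const.mul ((analyticAt_const.mul analyticAt_fst).add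
          (analyticAt_const.mul hsub))).neg.cexp
      refine h1.div (analyticAt_const.mul ((analyticAt_const.mul hE).mul (h2.pow N))) ?_
      have hfac : (i.factorial : ℂ) ≠ 0 := by exact_mod_cast i.factorial_ne_zero
      refine mul_ne_zero hfac (mul_ne_zero (mul_ne_zero (zpow_ne_zero _ (by norm_num))
        (Complex.exp_ne_zero _)) ?_)
      simp [hp₀, thetaQuot_zero hq]
    · filter_upwards [IsWeakJacobiForm.isOpen_im_fst_pos.mem_nhds τ₀.2] with p hp hl
      have hco : ((ofComplex p.1 : ℍ) : ℂ) = p.1 := by rw [ofComplex_apply_of_im_pos hp]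
      have ht := theta_pow_translate hφ hc h (ofComplex p.1) (p.2 - (m * p.1 + n)) m n
      rw [hco, show p.2 - (m * p.1 + n) + m * p.1 + n = p.2 by ring] at ht
      have hne : p.2 - (m * p.1 + n) ≠ 0 := fun h0 => hl ⟨m, n, by
        rw [hco]; linear_combination h0⟩
      rw [taylorCoeff_eq, hco, ht, theta, mul_pow, ← mul_div_assoc, mul_left_comm (_ * cexp _),
        mul_left_comm (i.factorial : ℂ), mul_div_mul_left _ _ (pow_ne_zero _ hne)]
  cusp := by
    -- The identity holds for every `α` off the lattice, so any `ε > 0` would do.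
    refine ⟨N, fun p => iteratedDeriv i (shiftQuot N p.1 p.2) 0 /
      (i.factorial * thetaQuot p.1 p.2 ^ N), 1, one_pos, ?_, fun τ α _ _ hα => ?_⟩
    · have hfac : (i.factorial : ℂ) ≠ 0 := by exact_mod_cast i.factorial_ne_zero
      have hq : ‖(0 : ℂ)‖ < 1 := by simp
      refine (analyticOnNhd_iteratedDeriv_shiftQuot N i (0, 0) hq).div
        (analyticAt_const.mul ((analyticOnNhd_thetaQuot (0, 0) hq).pow N)) ?_
      simp [thetaQuot_zero hq, hfac]
    · have hne : α ≠ 0 := fun h0 => hα (h0 ▸ zero_mem_lattice τ)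
      rw [taylorCoeff_eq, theta, mul_pow, ← mul_div_assoc, mul_left_comm (i.factorial : ℂ),
        mul_div_mul_left _ _ (pow_ne_zero N hne)]
      rfl

theorem isQuasiJacobiForm_taylorCoeff (hφ : IsWeakJacobiForm (-(N : ℤ)) N φ) (hc : c ≠ 0)
    (h : ∀ τ α, φ τ α = c * (α ^ N * thetaQuot (nome τ) α ^ N)) (i : ℕ) :
    IsQuasiJacobiForm (taylorCoeff N i) := by
  refine ⟨i, i, 0, completionCoeff N i, ⟨fun j _ l _ => ?_, fun τ α m n hα => ?_,
    fun γ τ α hα => ?_⟩, fun τ α _ => by simp [completionCoeff]⟩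
  -- The weight is `i` because the modular action rescales `t` by `cτ + d`; the depth is `(i, 0)`.
  · exact (isCoefficient_taylorCoeff hφ hc h (i - j)).const_mul _
  · rw [polyLamMu_completionCoeff, polyLamMu_completionCoeff,
      completedRatio_translate hφ hc h τ hα]
  · rw [polyLamMu_completionCoeff, polyLamMu_completionCoeff,
      completedRatio_modular hφ hc h γ τ hα, iteratedDeriv_comp_mul_left]
    simp [mul_div_assoc]

end JacobiForms

theorem mainTheorem6 (N : ℕ) (φ : ℍ → ℂ → ℂ)
    (hφ : JacobiForms.IsWeakJacobiForm (-(N : ℤ)) N φ)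
    (hne : ∃ (τ : ℍ) (α : ℂ), φ τ α ≠ 0) :
    (∀ τ : ℍ, iteratedDeriv N (φ τ) 0 ≠ 0) ∧
    (∀ (τ : ℍ) (α : ℂ), α ∉ JacobiForms.lattice τ → φ τ α ≠ 0) ∧
    ∃ F : ℕ → ℍ → ℂ → ℂ,
      (∀ (τ : ℍ) (α : ℂ), α ∉ JacobiForms.lattice τ →
        ∀ᶠ t : ℂ in 𝓝[≠] 0,
          φ τ t ≠ 0 ∧
          Summable (fun i : ℕ => F (i + 1) τ α * t ^ (i + 1)) ∧
          φ τ (t + α) / φ τ t =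
            (N.factorial : ℂ) * φ τ α / iteratedDeriv N (φ τ) 0 * (1 / t ^ N) *
              (1 + ∑' i : ℕ, F (i + 1) τ α * t ^ (i + 1))) ∧
      ∀ i : ℕ, 1 ≤ i → JacobiForms.IsQuasiJacobiForm (F i) := by
  open JacobiForms in
  obtain ⟨c, hc, h, hd⟩ := hφ.eq_const_mul hne
  have hfac : (N.factorial : ℂ) ≠ 0 := by exact_mod_cast N.factorial_ne_zero
  have hnz : ∀ (τ : ℍ) (α : ℂ), α ∉ lattice τ → φ τ α ≠ 0 := fun τ α hα => by
    rw [h, ← mul_pow]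
    exact mul_ne_zero hc (pow_ne_zero _ fun h0 => hα ((theta_eq_zero_iff τ α).1 h0))
  refine ⟨fun τ => by rw [hd]; exact mul_ne_zero hfac hc, hnz, taylorCoeff N,
    fun τ α hα => ?_, fun i _ => isQuasiJacobiForm_taylorCoeff hφ hc h i⟩
  have hq0 : ∀ᶠ t in 𝓝 0, thetaQuot (nome τ) t ≠ 0 :=
    (differentiable_thetaQuot τ).continuous.continuousAt.eventually_ne
      (by simp [thetaQuot_zero (norm_nome_lt_one τ.2)])
  filter_upwards [self_mem_nhdsWithin, nhdsWithin_le_nhds hq0,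
    nhdsWithin_le_nhds (eventually_hasSum_shiftRatio N τ α)] with t ht h1 h2
  have ht0 : t ≠ 0 := ht
  have hφt : φ τ t ≠ 0 := by
    rw [h]; exact mul_ne_zero hc (mul_ne_zero (pow_ne_zero _ ht0) (pow_ne_zero _ h1))
  refine ⟨hφt, (summable_nat_add_iff 1).2 h2.summable, ?_⟩
  have hs : 1 + ∑' i : ℕ, taylorCoeff N (i + 1) τ α * t ^ (i + 1) =
      shiftRatio N (nome τ) α t := by
    rw [← h2.tsum_eq, h2.summable.tsum_eq_zero_add]
    simp [taylorCoeff_zero N τ hα]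
  have hφα := hnz τ α hα
  rw [hs, shiftRatio_eq hc h τ α ht0, hd]
  field_simp
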